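/- All graphs are simple. For graphs $X$ and $Y$ with $|V(X)|=|V(Y)|$, let $\mathsf{FS}(X,Y)$ be the graph whose vertices are the bijections $\sigma\colon V(X)\to V(Y)$, where $\sigma$ and $\sigma'$ are adjacent if and only if there is an edge $\{a,b\}$ of $X$ such that $\{\sigma(a),\sigma(b)\}$ is an edge of $Y$, $\sigma(a)=\sigma'(b)$, $\sigma(b)=\sigma'(a)$, and $\sigma(c)=\sigma'(c)$ for all $c\in V(X)\setminus\{a,b\}$. Let $\mathsf{Cycle}_n$ be the cycle graph with vertex set $\{1,\ldots,n\}$ and edge set $\{\{i,i+1\}:1\le i\le n-1\}\cup\{\{n,1\}\}$. Let $Y$ be a graph with $n\ge 3$ vertices, and let $\overline Y$ be its complement. Then $\mathsf{FS}(\mathsf{Cycle}_n,Y)$ is connected if and only if $\overline Y$ is a forest consisting of trees $\mathscr T_1,\ldots,\mathscr T_r$ (its connected components) such that $\gcd(|V(\mathscr T_1)|,\ldots,|V(\mathscr T_r)|)=1$. -/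

import Mathlib

/-- The friends-and-strangers graph `FS(X, Y)`: its vertices are the bijections `σ : V(X) → V(Y)`,
and `σ`, `τ` are adjacent when `τ` arises from `σ` by an `(X, Y)`-friendly swap across an edge
`{a, b}` of `X`, that is, `{σ a, σ b}` is an edge of `Y`, the values at `a` and `b` are
interchanged, and `σ`, `τ` agree at every other vertex of `X`. -/
def friendsAndStrangers {V W : Type*} (X : SimpleGraph V) (Y : SimpleGraph W) :
    SimpleGraph (V ≃ W) where
  Adj σ τ := ∃ a b : V, X.Adj a b ∧ Y.Adj (σ a) (σ b) ∧
    σ a = τ b ∧ σ b = τ a ∧ ∀ c : V, c ≠ a → c ≠ b → σ c = τ c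
  symm := ⟨by
    rintro σ τ ⟨a, b, hX, hY, h1, h2, h3⟩
    refine ⟨a, b, hX, ?_, h2.symm, h1.symm, fun c ha hb => (h3 c ha hb).symm⟩
    rw [← h1, ← h2]
    exact hY.symm⟩
  loopless := ⟨by
    rintro σ ⟨a, b, hX, -, h1, -⟩
    exact hX.ne (σ.injective h1)⟩

open Finset

namespace FriendsAndStrangers

variable {V : Type*} {n : ℕ}

/-- The position on the cycle of the person `x` in the arrangement `σ`, as an integer. -/
def position (σ : Fin n ≃ V) (x : V) : ℤ := ((σ.symm x : Fin n) : ℕ)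

/-- The clockwise distance from `u` to `v` in the arrangement `σ`. -/
def arc (σ : Fin n ≃ V) (u v : V) : ℤ := (position σ v - position σ u) % n

/-- `D` records the net number of clockwise steps of each person in a motion from `σ` to `τ`
during which `G`-adjacent persons never pass each other. -/
structure IsDisplacement [Fintype V] (G : SimpleGraph V) (σ τ : Fin n ≃ V) (D : V → ℤ) :
    Prop where
  dvd : ∀ x, (n : ℤ) ∣ D x - (position τ x - position σ x)
  sum_eq_zero : ∑ x, D x = 0
  arc_sub_arc : ∀ u v, G.Adj u v → arc τ u v - arc σ u v = D v - D u

theorem position_nonneg (σ : Fin n ≃ V) (x : V) : 0 ≤ position σ x := by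
  simp [position]

theorem position_lt (σ : Fin n ≃ V) (x : V) : position σ x < n := by
  have := (σ.symm x).isLt
  simp only [position]
  exact_mod_cast this

theorem position_apply (σ : Fin n ≃ V) (i : Fin n) : position σ (σ i) = (i : ℕ) := by
  simp [position]

theorem eq_of_dvd_position_sub {σ : Fin n ≃ V} {x y : V}
    (h : (n : ℤ) ∣ position σ x - position σ y) : x = y := by
  have h0 : position σ x - position σ y = 0 := by
    refine Int.eq_zero_of_abs_lt_dvd h (abs_lt.2 ⟨?_, ?_⟩) <;>
      linarith [position_nonneg σ x, position_nonneg σ y, position_lt σ x, position_lt σ y]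
  have h1 : ((σ.symm x : Fin n) : ℕ) = (σ.symm y : Fin n) := by
    simp only [position] at h0
    omega
  exact σ.symm.injective (Fin.ext h1)

theorem dvd_arc_sub (σ : Fin n ≃ V) (u v : V) :
    (n : ℤ) ∣ arc σ u v - (position σ v - position σ u) := by
  rw [arc, Int.emod_def]
  exact ⟨-((position σ v - position σ u) / n), by ring⟩

theorem arc_lt [NeZero n] (σ : Fin n ≃ V) (u v : V) : arc σ u v < n :=
  Int.emod_lt_of_pos _ (by exact_mod_cast NeZero.pos n)

theorem arc_pos [NeZero n] (σ : Fin n ≃ V) {u v : V} (h : u ≠ v) : 0 < arc σ u v := by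
  have h0 : 0 ≤ arc σ u v := Int.emod_nonneg _ (by exact_mod_cast NeZero.ne n)
  refine lt_of_le_of_ne h0 fun h1 => h (eq_of_dvd_position_sub (σ := σ) ?_).symm
  exact Int.dvd_of_emod_eq_zero h1.symm

theorem arc_eq_of_dvd [NeZero n] {σ : Fin n ≃ V} {u v : V} {r : ℤ} (h0 : 0 ≤ r) (h1 : r < n)
    (h : (n : ℤ) ∣ r - (position σ v - position σ u)) : arc σ u v = r := by
  rw [arc, ← Int.emod_eq_of_lt h0 h1]
  exact (Int.emod_emod_of_dvd _ dvd_rfl).symm.trans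
    (by rw [Int.emod_emod_of_dvd _ dvd_rfl]; exact (Int.modEq_iff_dvd.2 h))

theorem dvd_val_add_one [NeZero n] (i : Fin n) :
    (n : ℤ) ∣ (((i + 1 : Fin n) : ℕ) : ℤ) - (i : ℕ) - 1 := by
  have h : ((i + 1 : Fin n) : ℕ) ≡ i + 1 [MOD n] := by
    rw [Fin.val_add, Fin.val_one']
    exact (Nat.mod_modEq _ _).trans ((Nat.ModEq.refl _).add (Nat.mod_modEq _ _))
  have := (Nat.modEq_iff_dvd.1 h.symm)
  push_cast at this
  rwa [sub_sub]

theorem position_swap (σ : Fin n ≃ V) (i j : Fin n) (x : V) :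
    position ((Equiv.swap i j).trans σ) x = (Equiv.swap i j (σ.symm x) : Fin n).val := by
  simp [position]

/-! ### Displacements of single swaps and of their composites -/

/-- The net displacement of a swap of the persons `x` and `y`, where `x` moves clockwise. -/
def swapDisplacement [DecidableEq V] (x y : V) : V → ℤ := Pi.single x 1 - Pi.single y 1

theorem dvd_swapDisplacement_sub [DecidableEq V] [NeZero n] (hn : 2 ≤ n) (σ : Fin n ≃ V)
    (i : Fin n) (x : V) :
    (n : ℤ) ∣ swapDisplacement (σ i) (σ (i + 1)) x -
      (position ((Equiv.swap i (i + 1)).trans σ) x - position σ x) := by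
  obtain ⟨k, rfl⟩ := σ.surjective x
  have hi := dvd_val_add_one i
  have hne : i + 1 ≠ i := by
    intro h
    rw [h] at hi
    have := Int.le_of_dvd one_pos (by simpa using hi)
    omega
  rw [position_swap, position_apply, σ.symm_apply_apply]
  rcases eq_or_ne k i with rfl | h1
  · refine hi.neg_right.trans (dvd_of_eq ?_)
    simp only [swapDisplacement, Pi.sub_apply, Pi.single_eq_same, Equiv.swap_apply_left,
      Pi.single_eq_of_ne (σ.injective.ne hne.symm)]
    ring
  rcases eq_or_ne k (i + 1) with rfl | h2
  · refine hi.trans (dvd_of_eq ?_)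
    simp only [swapDisplacement, Pi.sub_apply, Pi.single_eq_same, Equiv.swap_apply_right,
      Pi.single_eq_of_ne (σ.injective.ne hne)]
    ring
  · simp [swapDisplacement, h1, h2, Equiv.swap_apply_of_ne_of_ne]

section

variable [Fintype V] {G : SimpleGraph V} {σ τ ρ : Fin n ≃ V} {D E : V → ℤ}

theorem IsDisplacement.refl (G : SimpleGraph V) (σ : Fin n ≃ V) : IsDisplacement G σ σ 0 :=
  ⟨by simp, by simp, by simp⟩

theorem IsDisplacement.add (h₁ : IsDisplacement G σ τ D) (h₂ : IsDisplacement G τ ρ E) :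
    IsDisplacement G σ ρ (D + E) where
  dvd x := by
    exact (dvd_add (h₁.dvd x) (h₂.dvd x)).trans (dvd_of_eq (by simp only [Pi.add_apply]; ring))
  sum_eq_zero := by simp [sum_add_distrib, h₁.sum_eq_zero, h₂.sum_eq_zero]
  arc_sub_arc u v h := by
    simp only [Pi.add_apply]
    linarith [h₁.arc_sub_arc u v h, h₂.arc_sub_arc u v h]

theorem IsDisplacement.neg (h : IsDisplacement G σ τ D) : IsDisplacement G τ σ (-D) where
  dvd x := by
    exact ((h.dvd x).neg_right).trans (dvd_of_eq (by simp only [Pi.neg_apply]; ring))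
  sum_eq_zero := by simp [h.sum_eq_zero]
  arc_sub_arc u v huv := by
    simp only [Pi.neg_apply]
    linarith [h.arc_sub_arc u v huv]

theorem isDisplacement_swap [DecidableEq V] [NeZero n] (hn : 2 ≤ n) (σ : Fin n ≃ V)
    (i : Fin n) (hG : ¬ G.Adj (σ i) (σ (i + 1))) :
    IsDisplacement G σ ((Equiv.swap i (i + 1)).trans σ)
      (swapDisplacement (σ i) (σ (i + 1))) where
  dvd := dvd_swapDisplacement_sub hn σ i
  sum_eq_zero := by simp [swapDisplacement]
  arc_sub_arc u v huv := by
    set τ := (Equiv.swap i (i + 1)).trans σ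
    set D := swapDisplacement (σ i) (σ (i + 1)) with hD
    have hu := dvd_swapDisplacement_sub hn σ i u
    have hv := dvd_swapDisplacement_sub hn σ i v
    have hdvd : (n : ℤ) ∣ arc τ u v - arc σ u v - (D v - D u) := by
      exact (((dvd_arc_sub τ u v).sub (dvd_arc_sub σ u v)).sub (hv.sub hu)).trans (dvd_of_eq (by ring))
    have hbound : -1 ≤ D v - D u ∧ D v - D u ≤ 1 := by
      have hxy : ∀ x y, G.Adj x y → x = σ i → y ≠ σ (i + 1) := by
        rintro x y h rfl rfl
        exact hG h
      have h1 := hxy u v huv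
      have h2 := hxy v u huv.symm
      have h3 := huv.ne
      simp only [hD, swapDisplacement, Pi.sub_apply, Pi.single_apply]
      split_ifs <;> simp_all
    -- Both arcs lie in `[1, n - 1]` and `D v - D u` in `[-1, 1]`, so the discrepancy, a multiple of
    -- `n`, is smaller than `n`.
    have := Int.eq_zero_of_abs_lt_dvd hdvd (abs_lt.2 ⟨?_, ?_⟩)
    · linarith
    · linarith [arc_pos τ huv.ne, arc_lt σ u v]
    · linarith [arc_pos σ huv.ne, arc_lt τ u v]

end

/-! ### Reachability is equivalent to the existence of a displacement -/

theorem cycleGraph_adj_iff [NeZero n] (hn : 2 ≤ n) {i j : Fin n} :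
    (SimpleGraph.cycleGraph n).Adj i j ↔ j = i + 1 ∨ i = j + 1 := by
  have key : ∀ a b : Fin n, (b - a).val = 1 ↔ b = a + 1 := by
    intro a b
    have : (1 : Fin n).val = 1 := by rw [Fin.val_one', Nat.mod_eq_of_lt hn]
    rw [← this, ← Fin.ext_iff, sub_eq_iff_eq_add, add_comm]
  rw [SimpleGraph.cycleGraph_adj', key, key, or_comm]

theorem adj_iff_exists_swap [NeZero n] (hn : 2 ≤ n) (Y : SimpleGraph V) {σ τ : Fin n ≃ V} :
    (friendsAndStrangers (SimpleGraph.cycleGraph n) Y).Adj σ τ ↔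
      ∃ i, Y.Adj (σ i) (σ (i + 1)) ∧ τ = (Equiv.swap i (i + 1)).trans σ := by
  have key : ∀ a b : Fin n, σ a = τ b → σ b = τ a → (∀ c, c ≠ a → c ≠ b → σ c = τ c) →
      τ = (Equiv.swap a b).trans σ := by
    intro a b h1 h2 h3
    ext c
    rcases eq_or_ne c a with rfl | ha
    · simp [h2]
    rcases eq_or_ne c b with rfl | hb
    · simp [h1]
    · simp [Equiv.swap_apply_of_ne_of_ne ha hb, h3 c ha hb]
  constructor
  · rintro ⟨a, b, hX, hY, h1, h2, h3⟩
    rcases (cycleGraph_adj_iff hn).1 hX with rfl | rfl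
    · exact ⟨a, hY, key _ _ h1 h2 h3⟩
    · exact ⟨b, hY.symm, key _ _ h2 h1 fun c hb ha => h3 c ha hb⟩
  · rintro ⟨i, hY, rfl⟩
    refine ⟨i, i + 1, (cycleGraph_adj_iff hn).2 (Or.inl rfl), hY, by simp, by simp, ?_⟩
    intro c h1 h2
    simp [Equiv.swap_apply_of_ne_of_ne h1 h2]

variable [Fintype V]

theorem exists_isDisplacement_of_reachable [NeZero n] (hn : 2 ≤ n) (Y : SimpleGraph V)
    {σ τ : Fin n ≃ V}
    (h : (friendsAndStrangers (SimpleGraph.cycleGraph n) Y).Reachable σ τ) :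
    ∃ D, IsDisplacement Yᶜ σ τ D := by
  classical
  obtain ⟨p⟩ := h
  induction p with
  | nil => exact ⟨0, .refl _ _⟩
  | cons hadj _ ih =>
    obtain ⟨E, hE⟩ := ih
    obtain ⟨i, hY, rfl⟩ := (adj_iff_exists_swap hn Y).1 hadj
    exact ⟨_, (isDisplacement_swap hn _ i fun h => ((SimpleGraph.compl_adj _ _ _).1 h).2 hY).add hE⟩

/-- Both sides have the same sum around the cycle, so every inequality is an equality. -/
theorem eq_of_forall_le_add_one [NeZero n] {f : Fin n → ℤ} (h : ∀ i, f i ≤ f (i + 1))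
    (i : Fin n) : f i = f 0 := by
  have hsum : ∑ i, f i = ∑ i, f (i + 1) := (Equiv.sum_comp (Equiv.addRight (1 : Fin n)) f).symm
  have heq := (sum_eq_sum_iff_of_le fun i _ => h i).1 hsum
  have : ∀ k : ℕ, f (Fin.ofNat n k) = f 0 := by
    intro k
    induction k with
    | zero => rfl
    | succ k ih =>
      rw [← ih, heq (Fin.ofNat n k) (mem_univ _)]
      congr 1
      ext
      simp [Fin.val_add, Fin.ofNat]
  rw [← this i.val]
  congr 1
  ext
  simp

theorem sum_sq_sub_swapDisplacement [DecidableEq V] (D : V → ℤ) {x y : V} (hxy : x ≠ y) :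
    ∑ z, (D z - swapDisplacement x y z) ^ 2 = ∑ z, D z ^ 2 - 2 * (D x - D y) + 2 := by
  have : ∀ z, (D z - swapDisplacement x y z) ^ 2 =
      D z ^ 2 - 2 * ((Pi.single x (D x) : V → ℤ) z - (Pi.single y (D y) : V → ℤ) z) +
        ((Pi.single x 1 : V → ℤ) z + (Pi.single y 1 : V → ℤ) z) := by
    intro z
    rcases eq_or_ne z x with rfl | h1
    · simp [swapDisplacement, hxy]
      ring
    rcases eq_or_ne z y with rfl | h2
    · simp [swapDisplacement, hxy.symm]
      ring
    · simp [swapDisplacement, h1, h2]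
  simp only [this, sum_add_distrib, sum_sub_distrib, ← mul_sum, sum_pi_single', mem_univ, if_true]
  simp

/-- Descent on the sum of squares of `D`: swap neighbours of which the rear one has the larger
displacement. If there are none, `D` is constant, hence zero. -/
theorem reachable_of_isDisplacement [NeZero n] (hn : 2 ≤ n) (Y : SimpleGraph V)
    {σ τ : Fin n ≃ V} {D : V → ℤ} (h : IsDisplacement Yᶜ σ τ D) :
    (friendsAndStrangers (SimpleGraph.cycleGraph n) Y).Reachable σ τ := by
  classical
  induction hN : (∑ x, D x ^ 2).toNat using Nat.strong_induction_on generalizing σ D with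
  | _ N ih =>
    by_cases hmono : ∀ i, D (σ i) ≤ D (σ (i + 1))
    · have hconst : ∀ i, D (σ i) = D (σ 0) := eq_of_forall_le_add_one hmono
      have hzero : D (σ 0) = 0 := by
        have hs := h.sum_eq_zero
        rw [← Equiv.sum_comp σ, sum_congr rfl fun i _ => hconst i] at hs
        simpa [NeZero.ne n] using hs
      have : σ = τ := by
        ext i
        refine eq_of_dvd_position_sub (σ := τ) ?_
        have hi := h.dvd (σ i)
        have hD : D (σ i) = 0 := (hconst i).trans hzero
        have h2 : position σ (σ i) = position τ (τ i) := by simp [position_apply]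
        rw [hD, h2, zero_sub, dvd_neg] at hi
        exact hi
      rw [this]
    · push Not at hmono
      obtain ⟨i, hi⟩ := hmono
      have hne : σ i ≠ σ (i + 1) := fun h => by rw [← h] at hi; exact lt_irrefl _ hi
      -- With gap 1 the two neighbours would end at the same place in `τ`.
      have hgap : D (σ i) - D (σ (i + 1)) ≠ 1 := by
        intro hgap
        refine hne (eq_of_dvd_position_sub (σ := τ) ?_)
        have h1 := h.dvd (σ i)
        have h2 := h.dvd (σ (i + 1))
        have h3 := dvd_val_add_one i
        rw [position_apply] at h1 h2
        exact ((h2.sub h1).sub h3).trans (dvd_of_eq (by linarith))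
      -- Otherwise their arc, now 1, would shrink by at least 2 and become negative.
      have hY : Y.Adj (σ i) (σ (i + 1)) := by
        by_contra hY
        have hc := h.arc_sub_arc _ _ ((SimpleGraph.compl_adj _ _ _).2 ⟨hne, hY⟩)
        have hσ : arc σ (σ i) (σ (i + 1)) = 1 := by
          refine arc_eq_of_dvd zero_le_one (by exact_mod_cast hn) ?_
          rw [position_apply, position_apply]
          exact ((dvd_val_add_one i).neg_right).trans (dvd_of_eq (by ring))
        have := arc_pos τ hne
        omega
      have hE := (isDisplacement_swap (G := Yᶜ) hn σ i
        fun h => ((SimpleGraph.compl_adj _ _ _).1 h).2 hY).neg.add h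
      refine ((adj_iff_exists_swap hn Y).2 ⟨i, hY, rfl⟩).reachable.trans (ih _ ?_ hE rfl)
      -- The sum of squares changes by `2 - 2 * gap`, which is negative since the gap is at least 2.
      have hs := sum_sq_sub_swapDisplacement D hne
      have hnn : 0 ≤ ∑ z, (D z - swapDisplacement (σ i) (σ (i + 1)) z) ^ 2 :=
        sum_nonneg fun _ _ => sq_nonneg _
      simp only [Pi.add_apply, Pi.neg_apply, neg_add_eq_sub]
      omega

/-! ### Sufficiency: forests with coprime component sizes -/

/-- On a finite forest every antisymmetric function on the darts is a gradient. -/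
theorem exists_potential {G : SimpleGraph V} (hG : G.IsAcyclic) (w : V → V → ℤ)
    (hw : ∀ u v, G.Adj u v → w v u = -w u v) :
    ∃ E : V → ℤ, ∀ u v, G.Adj u v → E v - E u = w u v := by
  classical
  induction G using WellFoundedLT.induction with
  | _ G ih =>
    by_cases hbot : ∃ a b, G.Adj a b
    · obtain ⟨a, b, hab⟩ := hbot
      set H := G.deleteEdges {s(a, b)} with hH
      have hle : H ≤ G := G.deleteEdges_le _
      have hlt : H < G := by
        refine lt_of_le_of_ne hle fun h => ?_
        rw [← h, hH, SimpleGraph.deleteEdges_adj] at hab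
        exact hab.2 rfl
      obtain ⟨E, hE⟩ := ih H hlt (hG.anti hle) fun u v h => hw u v (hle h)
      have hbridge : ¬ H.Reachable a b :=
        SimpleGraph.isBridge_iff.1 (SimpleGraph.isAcyclic_iff_forall_adj_isBridge.1 hG hab)
      have hab' : (E b + if H.Reachable b b then w a b - (E b - E a) else 0) -
          (E a + if H.Reachable b a then w a b - (E b - E a) else 0) = w a b := by
        rw [if_pos (SimpleGraph.Reachable.refl b), if_neg fun h => hbridge h.symm]
        ring
      -- Shifting `E` by a constant on the side of `b` corrects the bridge and no other edge.
      refine ⟨fun x => E x + if H.Reachable b x then w a b - (E b - E a) else 0, fun u v huv => ?_⟩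
      by_cases he : s(u, v) = s(a, b)
      · rcases Sym2.eq_iff.1 he with ⟨rfl, rfl⟩ | ⟨rfl, rfl⟩
        · exact hab'
        · rw [hw _ _ hab]
          linarith
      · have hHuv : H.Adj u v := by
          rw [hH, SimpleGraph.deleteEdges_adj]
          exact ⟨huv, he⟩
        have hiff : H.Reachable b u ↔ H.Reachable b v :=
          ⟨fun h => h.trans hHuv.reachable, fun h => h.trans hHuv.symm.reachable⟩
        simp only [hiff, ← hE u v hHuv]
        ring
    · exact ⟨0, fun u v h => (hbot ⟨u, v, h⟩).elim⟩

theorem sum_component {G : SimpleGraph V} [Fintype G.ConnectedComponent]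
    (k : G.ConnectedComponent → ℤ) :
    ∑ x, k (G.connectedComponentMk x) = ∑ T, k T * (T.supp.ncard : ℤ) := by
  classical
  rw [← sum_fiberwise univ G.connectedComponentMk]
  refine sum_congr rfl fun T _ => ?_
  rw [sum_congr rfl (g := fun _ => k T) (fun x hx => by rw [(mem_filter.1 hx).2]), sum_const,
    nsmul_eq_mul, mul_comm]
  congr 2
  rw [← Set.ncard_coe_finset]
  congr 1
  ext x
  simp [SimpleGraph.ConnectedComponent.mem_supp_iff]

theorem exists_sum_mul_eq_of_gcd_eq_one {ι : Type*} (s : Finset ι) (f : ι → ℕ)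
    (h : s.gcd f = 1) (m : ℤ) : ∃ k : ι → ℤ, ∑ i ∈ s, k i * (f i : ℤ) = m := by
  obtain ⟨c, hc⟩ := s.gcd_eq_sum_mul fun i => (f i : ℤ)
  set g := s.gcd fun i => (f i : ℤ) with hg
  have hunit : g.natAbs ∣ 1 := by
    rw [← h]
    refine Finset.dvd_gcd fun i hi => ?_
    exact Int.natAbs_dvd_natAbs.2 (Finset.gcd_dvd (f := fun i => (f i : ℤ)) hi)
  obtain ⟨d, hd⟩ : g ∣ m := (Int.natAbs_dvd.1 (by simp [Nat.dvd_one.1 hunit]))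
  refine ⟨fun i => c i * d, ?_⟩
  rw [hd, hc, sum_mul]
  exact sum_congr rfl fun i _ => by ring

theorem sum_position_eq (σ τ : Fin n ≃ V) : ∑ x, position σ x = ∑ x, position τ x := by
  rw [← Equiv.sum_comp σ, ← Equiv.sum_comp τ]
  simp [position_apply]

theorem exists_isDisplacement [NeZero n] {G : SimpleGraph V} [Fintype G.ConnectedComponent]
    (hG : G.IsAcyclic) (hgcd : univ.gcd (fun T : G.ConnectedComponent => T.supp.ncard) = 1)
    (σ τ : Fin n ≃ V) : ∃ D, IsDisplacement G σ τ D := by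
  have harc : ∀ (ρ : Fin n ≃ V) {u v}, G.Adj u v → arc ρ v u = n - arc ρ u v := by
    intro ρ u v h
    refine arc_eq_of_dvd (by linarith [arc_lt ρ u v]) (by linarith [arc_pos ρ h.ne]) ?_
    exact ((dvd_refl (n : ℤ)).sub (dvd_arc_sub ρ u v)).trans (dvd_of_eq (by ring))
  have hn0 : (n : ℤ) ≠ 0 := by exact_mod_cast NeZero.ne n
  let P : V → ℤ := fun x => position τ x - position σ x
  have hdvd : ∀ u v, (n : ℤ) ∣ arc τ u v - arc σ u v - (P v - P u) := by
    intro u v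
    exact ((dvd_arc_sub τ u v).sub (dvd_arc_sub σ u v)).trans (dvd_of_eq (by ring))
  choose w hw using hdvd
  obtain ⟨E, hE⟩ := exists_potential hG w fun u v h => by
    refine mul_left_cancel₀ hn0 ?_
    rw [← hw, mul_neg, ← hw, harc τ h, harc σ h]
    ring
  -- `P` already sums to zero, so the constants `k` only have to cancel the sum of `E`.
  obtain ⟨k, hk⟩ := exists_sum_mul_eq_of_gcd_eq_one _ _ hgcd (-∑ x, E x)
  rw [← sum_component] at hk
  refine ⟨fun x => P x + n * (E x + k (G.connectedComponentMk x)), fun x => ?_, ?_, ?_⟩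
  · exact ⟨E x + k (G.connectedComponentMk x), by ring⟩
  · rw [sum_add_distrib, ← mul_sum, sum_add_distrib, hk, sum_sub_distrib, sum_position_eq σ τ]
    ring
  · intro u v h
    rw [SimpleGraph.ConnectedComponent.connectedComponentMk_eq_of_adj h]
    linear_combination hw u v - (n : ℤ) * hE u v h

/-! ### Necessity of both conditions -/

/-- Swap the ends of a non-bridge edge, placed side by side. Without that edge, the swap
displacement `S` is legal and agrees with `D` up to a constant on each component, so `D` differs by
-2 across the edge, whereas the arc grows from 1 to `n - 1`. -/
theorem isAcyclic_of_forall_exists_isDisplacement [NeZero n] (hn : 3 ≤ n) {G : SimpleGraph V}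
    (e : Fin n ≃ V) (h : ∀ σ τ : Fin n ≃ V, ∃ D, IsDisplacement G σ τ D) : G.IsAcyclic := by
  classical
  rw [SimpleGraph.isAcyclic_iff_forall_adj_isBridge]
  intro u v huv
  rw [SimpleGraph.isBridge_iff]
  intro hreach
  have h01 : (0 : Fin n) ≠ 0 + 1 := by
    rw [zero_add]
    intro h
    have := congrArg Fin.val h
    rw [Fin.val_one', Nat.mod_eq_of_lt (by omega)] at this
    simp at this
  obtain ⟨σ, rfl, rfl⟩ : ∃ σ : Fin n ≃ V, σ 0 = u ∧ σ (0 + 1) = v := by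
    let e₁ := e.trans (Equiv.swap (e 0) u)
    have he₁ : e₁ 0 = u := by simp [e₁]
    refine ⟨e₁.trans (Equiv.swap (e₁ (0 + 1)) v), ?_, by simp⟩
    rw [Equiv.trans_apply, Equiv.swap_apply_of_ne_of_ne (e₁.injective.ne h01) (he₁ ▸ huv.ne), he₁]
  set τ := (Equiv.swap (0 : Fin n) (0 + 1)).trans σ with hτ
  obtain ⟨D, hD⟩ := h σ τ
  set G' := G.deleteEdges {s(σ 0, σ (0 + 1))} with hG'
  have hD' := isDisplacement_swap (G := G') (by omega : 2 ≤ n) σ 0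
    (by simp [hG', SimpleGraph.deleteEdges_adj])
  set S := swapDisplacement (σ 0) (σ (0 + 1)) with hS
  have hconst : ∀ {x y}, G'.Reachable x y → D x - S x = D y - S y := by
    rintro x y ⟨p⟩
    induction p with
    | nil => rfl
    | @cons a b _ hadj _ ih =>
      rw [← ih]
      have h1 := hD.arc_sub_arc a b (G.deleteEdges_le _ hadj)
      have h2 := hD'.arc_sub_arc a b hadj
      linarith
  have hval : ((0 + 1 : Fin n) : ℕ) = 1 := by
    rw [zero_add, Fin.val_one', Nat.mod_eq_of_lt (by omega)]
  have hn' : (3 : ℤ) ≤ n := by exact_mod_cast hn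
  have hσarc : arc σ (σ 0) (σ (0 + 1)) = 1 := by
    refine arc_eq_of_dvd zero_le_one (by linarith) ?_
    rw [position_apply, position_apply, hval]
    simp
  have hτarc : arc τ (σ 0) (σ (0 + 1)) = n - 1 := by
    refine arc_eq_of_dvd (by linarith) (by linarith) ?_
    rw [position_swap, position_swap, σ.symm_apply_apply, σ.symm_apply_apply,
      Equiv.swap_apply_left, Equiv.swap_apply_right, hval]
    simp
  have h1 := hD.arc_sub_arc _ _ huv
  have h2 := hconst hreach
  have h3 : S (σ 0) = 1 := by
    rw [hS, swapDisplacement, Pi.sub_apply, Pi.single_eq_same,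
      Pi.single_eq_of_ne (σ.injective.ne h01), sub_zero]
  have h4 : S (σ (0 + 1)) = -1 := by
    rw [hS, swapDisplacement, Pi.sub_apply, Pi.single_eq_same,
      Pi.single_eq_of_ne (σ.injective.ne h01.symm), zero_sub]
  linarith

/-- Rotation by one place preserves all arcs, so `D` is constant on components, of the form `1 + n *
k T`. Total zero then writes -1 as an integer combination of the component sizes. -/
theorem gcd_eq_one_of_forall_exists_isDisplacement [NeZero n] {G : SimpleGraph V}
    [Fintype G.ConnectedComponent] (σ : Fin n ≃ V)
    (h : ∀ σ τ : Fin n ≃ V, ∃ D, IsDisplacement G σ τ D) :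
    univ.gcd (fun T : G.ConnectedComponent => T.supp.ncard) = 1 := by
  set τ := (Equiv.subRight (1 : Fin n)).trans σ with hτ
  obtain ⟨D, hD⟩ := h σ τ
  have hpos : ∀ x, (n : ℤ) ∣ position τ x - position σ x - 1 := fun x => by
    have := dvd_val_add_one (σ.symm x)
    simpa [position, hτ] using this
  have hn0 : (n : ℤ) ≠ 0 := by exact_mod_cast NeZero.ne n
  have harc : ∀ u v, arc τ u v = arc σ u v := fun u v => by
    refine arc_eq_of_dvd (Int.emod_nonneg _ hn0) (arc_lt σ u v) ?_
    exact (((dvd_arc_sub σ u v).sub (hpos v)).add (hpos u)).trans (dvd_of_eq (by ring))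
  have hconst : ∀ {x y}, G.Reachable x y → D x = D y := by
    rintro x y ⟨p⟩
    induction p with
    | nil => rfl
    | @cons a b _ hadj _ ih =>
      have := hD.arc_sub_arc a b hadj
      rw [harc] at this
      linarith
  have hdvd : ∀ x, (n : ℤ) ∣ D x - 1 := fun x => by
    exact ((hD.dvd x).add (hpos x)).trans (dvd_of_eq (by ring))
  have hk : ∀ T : G.ConnectedComponent, ∃ k : ℤ, ∀ x, G.connectedComponentMk x = T →
      D x = 1 + n * k := by
    intro T
    obtain ⟨r, rfl⟩ := T.exists_rep
    obtain ⟨k, hk⟩ := hdvd r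
    exact ⟨k, fun x hx => by
      rw [hconst (SimpleGraph.ConnectedComponent.exact hx)]; linarith⟩
  choose k hk using hk
  have hsum := hD.sum_eq_zero
  have hcard : Fintype.card V = n := by simpa using (Fintype.card_congr σ).symm
  rw [sum_congr rfl fun x _ => hk _ x rfl, sum_add_distrib, ← mul_sum, sum_component] at hsum
  have hsum' : ∑ T, k T * (T.supp.ncard : ℤ) = -1 := by
    refine mul_left_cancel₀ hn0 ?_
    simp only [sum_const, card_univ, hcard, nsmul_eq_mul, mul_one] at hsum
    linarith
  refine Nat.dvd_one.1 (Int.natCast_dvd_natCast.1 ?_)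
  rw [Nat.cast_one, ← dvd_neg, ← hsum']
  exact dvd_sum fun T hT =>
    (Int.natCast_dvd_natCast.2 (Finset.gcd_dvd hT)).mul_left _

end FriendsAndStrangers

open FriendsAndStrangers in
theorem corollary4p10 {V : Type*} [Fintype V] (n : ℕ) (hn : 3 ≤ n) (hV : Fintype.card V = n)
    (Y : SimpleGraph V) [Fintype Yᶜ.ConnectedComponent] :
    (friendsAndStrangers (SimpleGraph.cycleGraph n) Y).Connected ↔
      Yᶜ.IsAcyclic ∧
        Finset.univ.gcd (fun T : Yᶜ.ConnectedComponent => T.supp.ncard) = 1 := by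
  have : NeZero n := ⟨by omega⟩
  have hn2 : 2 ≤ n := by omega
  let e : Fin n ≃ V := (Fintype.equivFinOfCardEq hV).symm
  constructor
  · intro h
    have hdisp : ∀ σ τ : Fin n ≃ V, ∃ D, IsDisplacement Yᶜ σ τ D := fun σ τ =>
      exists_isDisplacement_of_reachable hn2 Y (h.preconnected σ τ)
    exact ⟨isAcyclic_of_forall_exists_isDisplacement hn e hdisp,
      gcd_eq_one_of_forall_exists_isDisplacement e hdisp⟩
  · rintro ⟨hacyc, hgcd⟩
    refine (SimpleGraph.connected_iff _).2 ⟨fun σ τ => ?_, ⟨e⟩⟩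
    obtain ⟨D, hD⟩ := exists_isDisplacement hacyc hgcd σ τ
    exact reachable_of_isDisplacement hn2 Y hD
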